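/- **Theorem.** Let $N\ge 1$ and consider $N$ agents with (possibly different) linear dynamics $\dot{\breve x}_i=\breve A_i\breve x_i+\breve B_iu_i$, $y_i=\breve C_i\breve x_i$, $i\in\mathcal N=\{1,\dots,N\}$, with $\breve x_i(t)\in\mathbb R^{n_i}$, $u_i(t)\in\mathbb R^{m_i}$, $y_i(t)\in\mathbb R^{p_i}$, where every pair $(\breve A_i,\breve C_i)$ is detectable and every $u_i$ is bounded on $[0,\infty)$. Put $n=\sum_i n_i$, $x=\mathrm{col}(\breve x_1,\dots,\breve x_N)\in\mathbb R^n$ and $A=\mathrm{diag}(\breve A_1,\dots,\breve A_N)$. Let $T_{id}\in\mathbb R^{n\times n_i}$ be the matrix with $I_{n_i}$ in the $i$th block of rows and zeros elsewhere, let $B_i=T_{id}\breve B_i$, and let $T_{iu}\in\mathbb R^{n\times(n-n_i)}$ be any matrix with $T_{id}^\top T_{iu}=0$, $T_{iu}^\top T_{iu}=I_{n-n_i}$ and $T_{iu}T_{iu}^\top=I_n-T_{id}T_{id}^\top$. Choose $\breve L_i$ such that all eigenvalues of $\breve A_i+\breve L_i\breve C_i$ have negative real parts. Let the agents communicate over a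 connected undirected weighted graph without self-loops, with weights $a_{ij}=a_{ji}\ge 0$ ($a_{ij}>0$ exactly when $i$ and $j$ are joined by an edge). Let $h(\omega)=\omega/\|\omega\|$ for $\omega\ne0$ and $h(0)=0$. Suppose that agent $i$, for every $i\in\mathcal N$, runs $$\dot{\hat x}_i=\bar E_i\hat x_i+\bar F_iy_i+B_iu_i-\gamma_iT_{iu}\varepsilon_{iu}-\gamma_{is}T_{iu}h(\varepsilon_{iu}),\qquad \hat x_i(0)=0,$$ $$\varepsilon_{iu}=T_{iu}^\top\sum_{j=1}^Na_{ij}(\hat x_i-\hat x_j),\qquad \dot\gamma_i=\phi_i\|\varepsilon_{iu}\|^2,\qquad \dot\gamma_{is}=\phi_{is}\|\varepsilon_{iu}\|,$$ with $\bar E_i=T_{id}(\breve A_i+\breve L_i\breve C_i)T_{id}^\top+T_{iu}T_{iu}^\top A$, $\bar F_i=-T_{id}\breve L_i$, step sizes $\phi_i,\phi_{is}>0$ and initial gains $\gamma_i(0),\gamma_{is}(0)>0$. Then, for every initial state $x(0)$ and every solution on $[0,\infty)$ (understood in the sense of Filippov at the discontinuity of $h$), $$\lim_{t\to\infty}\|\hat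 x_i(t)-x(t)\|=0\qquad\text{for all } i\in\mathcal N,$$ and the adaptive gains $\gamma_i$ and $\gamma_{is}$ are bounded on $[0,\infty)$ for all $i\in\mathcal N$. -/

import Mathlib

open Filter Topology MeasureTheory

noncomputable section

namespace HeteroMAS

/-- A real square matrix all of whose (complex) eigenvalues have negative real part. -/
def IsHurwitz {ι : Type*} [Fintype ι] [DecidableEq ι] (M : Matrix ι ι ℝ) : Prop :=
  ∀ μ ∈ spectrum ℂ (M.map (algebraMap ℝ ℂ)), μ.re < 0

/-- `(A, C)` is detectable: some output injection `L` makes `A + L C` Hurwitz. -/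
def IsDetectable {n p : ℕ} (A : Matrix (Fin n) (Fin n) ℝ) (C : Matrix (Fin p) (Fin n) ℝ) : Prop :=
  ∃ L : Matrix (Fin n) (Fin p) ℝ, IsHurwitz (A + L * C)

/-- An undirected weighted graph without self-loops on the nodes `Fin N`, given by its
adjacency matrix: `weight i j > 0` if there is an edge between `i` and `j`, and
`weight i j = 0` otherwise. -/
structure CommGraph (N : ℕ) where
  weight : Fin N → Fin N → ℝ
  nonneg : ∀ i j, 0 ≤ weight i j
  symm : ∀ i j, weight i j = weight j i
  noLoop : ∀ i, weight i i = 0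

/-- The underlying simple graph of a weighted undirected graph. -/
def CommGraph.graph {N : ℕ} (G : CommGraph N) : SimpleGraph (Fin N) where
  Adj i j := 0 < G.weight i j
  symm := ⟨fun i j h => by rw [G.symm j i]; exact h⟩
  loopless := ⟨fun i h => by rw [G.noLoop i] at h; exact lt_irrefl 0 h⟩

/-- The data of a heterogeneous multi-agent system with `N` agents
`ẋ_i = A_i x_i + B_i u_i`, `y_i = C_i x_i`. -/
structure System (N : ℕ) where
  n : Fin N → ℕ
  m : Fin N → ℕ
  p : Fin N → ℕ
  A : ∀ i, Matrix (Fin (n i)) (Fin (n i)) ℝ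
  B : ∀ i, Matrix (Fin (n i)) (Fin (m i)) ℝ
  C : ∀ i, Matrix (Fin (p i)) (Fin (n i)) ℝ

variable {N : ℕ}

/-- Coordinates of the overall state: the `k`-th coordinate of the `i`-th agent. -/
abbrev System.Idx (S : System N) : Type := Σ i : Fin N, Fin (S.n i)

/-- The dimension `n - n_i` of the part of the overall state that does not belong to agent `i`,
where `n = ∑ j, n_j`. -/
abbrev System.codim (S : System N) (i : Fin N) : ℕ := (∑ j, S.n j) - S.n i

/-- The overall state `x = col(x_1, …, x_N)`. -/
def System.stack (S : System N) (x : ∀ i, EuclideanSpace ℝ (Fin (S.n i))) :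
    EuclideanSpace ℝ S.Idx :=
  WithLp.toLp 2 fun q => x q.1 q.2

/-- The overall system matrix `A = diag(A_1, …, A_N)`. -/
def System.bigA (S : System N) : Matrix S.Idx S.Idx ℝ := Matrix.blockDiagonal' S.A

/-- `T_id = [0 I 0]ᵀ`, with the identity in the block of agent `i`. -/
def System.Td (S : System N) (i : Fin N) : Matrix S.Idx (Fin (S.n i)) ℝ :=
  Matrix.of fun q k => if q = ⟨i, k⟩ then 1 else 0

/-- The input matrix `[0 B_iᵀ 0]ᵀ` of agent `i` in the overall system. -/
def System.bigB (S : System N) (i : Fin N) : Matrix S.Idx (Fin (S.m i)) ℝ := S.Td i * S.B i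

/-- `T_iu` is an orthonormal completion of `T_id`. -/
structure System.IsCompletion (S : System N) (i : Fin N)
    (Tu : Matrix S.Idx (Fin (S.codim i)) ℝ) : Prop where
  orth : (S.Td i).transpose * Tu = 0
  gram : Tu.transpose * Tu = 1
  proj : Tu * Tu.transpose = 1 - S.Td i * (S.Td i).transpose

/-- The gain `T_id (A_i + L_i C_i) T_idᵀ + T_iu T_iuᵀ A`. -/
def System.barE (S : System N) (i : Fin N) (L : Matrix (Fin (S.n i)) (Fin (S.p i)) ℝ)
    (Tu : Matrix S.Idx (Fin (S.codim i)) ℝ) : Matrix S.Idx S.Idx ℝ :=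
  S.Td i * (S.A i + L * S.C i) * (S.Td i).transpose + Tu * Tu.transpose * S.bigA

/-- The gain `- T_id L_i`. -/
def System.barF (S : System N) (i : Fin N) (L : Matrix (Fin (S.n i)) (Fin (S.p i)) ℝ) :
    Matrix S.Idx (Fin (S.p i)) ℝ :=
  -(S.Td i * L)

/-- The unit-direction function: `h w = w / ‖w‖` for `w ≠ 0`, and `h 0 = 0`. -/
def h {k : ℕ} (w : EuclideanSpace ℝ (Fin k)) : EuclideanSpace ℝ (Fin k) :=
  open Classical in if w = 0 then 0 else ‖w‖⁻¹ • w

/-- The Filippov regularization of the discontinuous function `h`: it is `{h w}` for `w ≠ 0`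
and the closed unit ball at `w = 0`. In particular it always contains `h w`. -/
def hSet {k : ℕ} (w : EuclideanSpace ℝ (Fin k)) : Set (EuclideanSpace ℝ (Fin k)) :=
  {v | ‖v‖ ≤ 1 ∧ (w ≠ 0 → v = h w)}

/-- `f` is absolutely continuous on every compact subinterval of `[0, ∞)` and, for almost every
`t ≥ 0`, its derivative exists and belongs to `F t`. -/
structure IsSolution {E : Type*} [NormedAddCommGroup E] [NormedSpace ℝ E]
    (f : ℝ → E) (F : ℝ → Set E) : Prop where
  ac : ∀ T : ℝ, 0 ≤ T → AbsolutelyContinuousOnInterval f 0 T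
  deriv : ∀ᵐ t ∂(volume.restrict (Set.Ici (0 : ℝ))), ∃ v ∈ F t, HasDerivAt f v t

/-- `x` is a trajectory of the multi-agent system under the input signals `u`. -/
def System.IsTrajectory (S : System N) (u : ∀ i, ℝ → EuclideanSpace ℝ (Fin (S.m i)))
    (x : ∀ i, ℝ → EuclideanSpace ℝ (Fin (S.n i))) : Prop :=
  ∀ i, IsSolution (x i) fun t =>
    {(S.A i).toEuclideanLin (x i t) + (S.B i).toEuclideanLin (u i t)}

/-- The measured output `y_i = C_i x_i`. -/
def System.output (S : System N) (i : Fin N) (x : EuclideanSpace ℝ (Fin (S.n i))) :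
    EuclideanSpace ℝ (Fin (S.p i)) :=
  (S.C i).toEuclideanLin x

/-- `ε_iu = T_iuᵀ ∑ j, a_ij (x̂_i - x̂_j)`. -/
def System.epsU (S : System N) (G : CommGraph N)
    (Tu : ∀ i, Matrix S.Idx (Fin (S.codim i)) ℝ)
    (xhat : Fin N → ℝ → EuclideanSpace ℝ S.Idx) (i : Fin N) (t : ℝ) :
    EuclideanSpace ℝ (Fin (S.codim i)) :=
  (Tu i).transpose.toEuclideanLin (∑ j, G.weight i j • (xhat i t - xhat j t))

/-- The estimates `x̂_i` and the adaptive gains `γ_i`, `γ_is` evolve (in the sense of Filippov)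
according to the distributed observer
`x̂_i' = Ē_i x̂_i + F̄_i y_i + B_i u_i - (γ_i T_iu ε_iu + γ_is T_iu h(ε_iu))`, `x̂_i(0) = 0`,
`γ_i' = φ_i ‖ε_iu‖²`, `γ_is' = φ_is ‖ε_iu‖`, with positive initial gains. -/
structure System.IsObserver (S : System N) (G : CommGraph N)
    (L : ∀ i, Matrix (Fin (S.n i)) (Fin (S.p i)) ℝ)
    (Tu : ∀ i, Matrix S.Idx (Fin (S.codim i)) ℝ)
    (phi phis : Fin N → ℝ)
    (u : ∀ i, ℝ → EuclideanSpace ℝ (Fin (S.m i)))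
    (x : ∀ i, ℝ → EuclideanSpace ℝ (Fin (S.n i)))
    (xhat : Fin N → ℝ → EuclideanSpace ℝ S.Idx)
    (gam gams : Fin N → ℝ → ℝ) : Prop where
  xhat_zero : ∀ i, xhat i 0 = 0
  gam_zero : ∀ i, 0 < gam i 0
  gams_zero : ∀ i, 0 < gams i 0
  xhat_sol : ∀ i, IsSolution (xhat i) fun t =>
    {w | ∃ v ∈ hSet (S.epsU G Tu xhat i t),
      w = (S.barE i (L i) (Tu i)).toEuclideanLin (xhat i t)
        + (S.barF i (L i)).toEuclideanLin (S.output i (x i t))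
        + (S.bigB i).toEuclideanLin (u i t)
        - (gam i t • (Tu i).toEuclideanLin (S.epsU G Tu xhat i t)
          + gams i t • (Tu i).toEuclideanLin v)}
  gam_sol : ∀ i, IsSolution (gam i) fun t => {phi i * ‖S.epsU G Tu xhat i t‖ ^ 2}
  gams_sol : ∀ i, IsSolution (gams i) fun t => {phis i * ‖S.epsU G Tu xhat i t‖}

end HeteroMAS

end

/-! Let `e i` be the estimate of agent `i` minus the true state. In the agent's own coordinates the
error solves an autonomous equation with matrix `A i + L i * C i`, which is Hurwitz, so this part is
bounded and square integrable. In the other coordinates it is driven by the unknown dynamics, by the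
bounded inputs of the other agents, and by the feedback in the disagreement `ε i`, the non-own part
of the graph Laplacian applied to the errors.

The Lyapunov function is half the Laplacian energy of the errors plus the weighted squared distances
of the gains from the targets `κ + 1` and `b`. The adaptation laws replace the actual gains by these
targets in its derivative: `b` dominates the inputs, and `κ + 1` the quadratic cross terms with one
unit to spare. What remains is at most `κ * ∑ ‖own error‖² - ∑ ‖ε i‖²`, whose positive part is
integrable. Hence the gains and the energy are bounded and `ε` is square integrable.

The quadratic cross terms are controlled because the own errors and the `ε i` together dominate the
whole error (`exists_norm_sq_le_disagreement`): if all of them vanish, so does the Laplacian energy,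
connectedness makes the `e i` equal, and the common value is zero in every agent's block. The same
inequality makes `‖e i‖²` integrable. Its derivative is bounded, so a Barbalat argument
(`tendsto_zero_of_integrable_of_ae_deriv_le`) gives convergence. -/

/-! ### Calculus of absolutely continuous functions. -/

theorem AbsolutelyContinuousOnInterval.lipschitz_comp {X Y : Type*} [PseudoMetricSpace X]
    [PseudoMetricSpace Y] {f : ℝ → X} {a b : ℝ} (hf : AbsolutelyContinuousOnInterval f a b)
    {K : NNReal} {g : X → Y} (hg : LipschitzWith K g) :
    AbsolutelyContinuousOnInterval (fun t => g (f t)) a b := by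
  unfold AbsolutelyContinuousOnInterval at *
  refine squeeze_zero (fun t => Finset.sum_nonneg fun i _ => dist_nonneg) (fun t => ?_)
    (by simpa using hf.const_mul (K : ℝ))
  rw [Finset.mul_sum]
  exact Finset.sum_le_sum fun i _ => hg.dist_le_mul _ _

theorem AbsolutelyContinuousOnInterval.norm_sq {F : Type*} [NormedAddCommGroup F]
    {f : ℝ → F} {a b : ℝ} (hf : AbsolutelyContinuousOnInterval f a b) :
    AbsolutelyContinuousOnInterval (fun t => ‖f t‖ ^ 2) a b := by
  have h : AbsolutelyContinuousOnInterval (fun t => ‖f t‖) a b :=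
    hf.lipschitz_comp lipschitzWith_one_norm
  simpa only [pow_two] using h.fun_mul h

/-- Polarization reduces inner products to squared norms. -/
theorem AbsolutelyContinuousOnInterval.fun_inner {F : Type*} [NormedAddCommGroup F]
    [InnerProductSpace ℝ F] {f g : ℝ → F} {a b : ℝ} (hf : AbsolutelyContinuousOnInterval f a b)
    (hg : AbsolutelyContinuousOnInterval g a b) :
    AbsolutelyContinuousOnInterval (fun t => inner ℝ (f t) (g t)) a b := by
  have h := ((hf.fun_add hg).norm_sq.fun_sub (hf.fun_sub hg).norm_sq).const_mul (1 / 4 : ℝ)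
  refine (congrArg (fun k => AbsolutelyContinuousOnInterval k a b) (funext fun t => ?_)).mp h
  rw [norm_add_sq_real, norm_sub_sq_real]
  ring

theorem AbsolutelyContinuousOnInterval.const {F : Type*} [PseudoMetricSpace F] (c : F) (a b : ℝ) :
    AbsolutelyContinuousOnInterval (fun _ => c) a b :=
  ((LipschitzWith.const c).lipschitzOnWith (s := Set.uIcc a b)).absolutelyContinuousOnInterval

theorem AbsolutelyContinuousOnInterval.fun_finset_sum {F ι : Type*} [NormedAddCommGroup F]
    {a b : ℝ} {f : ι → ℝ → F} (s : Finset ι)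
    (hf : ∀ i ∈ s, AbsolutelyContinuousOnInterval (f i) a b) :
    AbsolutelyContinuousOnInterval (fun t => ∑ i ∈ s, f i t) a b := by
  classical
  induction s using Finset.induction_on with
  | empty => simpa using AbsolutelyContinuousOnInterval.const (0 : F) a b
  | insert i s hi ih =>
    simp only [Finset.sum_insert hi]
    exact (hf i (Finset.mem_insert_self _ _)).fun_add
      (ih fun j hj => hf j (Finset.mem_insert_of_mem hj))

theorem continuousOn_Ici_of_absolutelyContinuous {F : Type*} [NormedAddCommGroup F] {f : ℝ → F}
    (hf : ∀ T : ℝ, 0 ≤ T → AbsolutelyContinuousOnInterval f 0 T) :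
    ContinuousOn f (Set.Ici 0) := by
  intro t ht
  have ht0 : (0 : ℝ) ≤ t := ht
  have h := (hf (t + 1) (by linarith)).continuousOn
  rw [Set.uIcc_of_le (by linarith)] at h
  refine (h t ⟨ht0, by linarith⟩).mono_of_mem_nhdsWithin ?_
  exact mem_nhdsWithin.mpr ⟨Set.Iio (t + 1), isOpen_Iio, by simp, fun s hs => ⟨hs.2, le_of_lt hs.1⟩⟩

/-! ### Lyapunov and Barbalat estimates with derivatives almost everywhere. -/

/-- An absolutely continuous function grows at most by the integral of a bound on its
derivative. -/
theorem sub_le_integral_of_ae_deriv_le {f g : ℝ → ℝ} {a b : ℝ} (ha : 0 ≤ a) (hab : a ≤ b)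
    (hf : AbsolutelyContinuousOnInterval f 0 b) (hg : IntervalIntegrable g volume a b)
    (hfg : ∀ᵐ t ∂(volume.restrict (Set.Ici (0 : ℝ))), ∃ v, HasDerivAt f v t ∧ v ≤ g t) :
    f b - f a ≤ ∫ t in a..b, g t := by
  have hf' : AbsolutelyContinuousOnInterval f a b := by
    refine hf.mono ?_
    rw [Set.uIcc_of_le hab, Set.uIcc_of_le (ha.trans hab)]
    exact Set.Icc_subset_Icc_left ha
  rw [← hf'.integral_deriv_eq_sub]
  refine intervalIntegral.integral_mono_ae_restrict hab hf'.intervalIntegrable_deriv hg ?_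
  have h := ae_mono (Measure.restrict_mono (μ := volume) (fun t (ht : t ∈ Set.Icc a b) =>
    (ha.trans ht.1 : (0 : ℝ) ≤ t)) le_rfl) hfg
  filter_upwards [h] with t ⟨v, hv, hvg⟩
  rwa [hv.deriv]

theorem intervalIntegrable_of_continuousOn_Ici {w : ℝ → ℝ} (hw : ContinuousOn w (Set.Ici 0))
    {a b : ℝ} (ha : 0 ≤ a) (hb : 0 ≤ b) : IntervalIntegrable w volume a b := by
  refine (hw.mono fun t ht => ?_).intervalIntegrable
  exact (le_inf ha hb).trans ht.1

/-- A Lyapunov-type estimate: if `V ≥ 0` and `V' ≤ q - w` with `w ≥ 0` and `q ≥ 0` integrable,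
then `V` is bounded and `w` is integrable. -/
theorem bounded_and_integrable_of_ae_deriv_le {V q w : ℝ → ℝ}
    (hV : ∀ T : ℝ, 0 ≤ T → AbsolutelyContinuousOnInterval V 0 T)
    (hV0 : ∀ t, 0 ≤ t → 0 ≤ V t) (hw : ContinuousOn w (Set.Ici 0)) (hw0 : ∀ t, 0 ≤ w t)
    (hq0 : ∀ t, 0 ≤ q t) (hq : IntegrableOn q (Set.Ioi 0))
    (hd : ∀ᵐ t ∂(volume.restrict (Set.Ici (0 : ℝ))), ∃ v, HasDerivAt V v t ∧ v ≤ q t - w t) :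
    (∃ C, ∀ t, 0 ≤ t → V t ≤ C) ∧ IntegrableOn w (Set.Ioi 0) := by
  have key : ∀ T, 0 ≤ T → V T + ∫ t in (0 : ℝ)..T, w t ≤ V 0 + ∫ t in Set.Ioi 0, q t := by
    intro T hT
    have hqi : IntervalIntegrable q volume 0 T :=
      (intervalIntegrable_iff_integrableOn_Ioc_of_le hT).mpr (hq.mono_set Set.Ioc_subset_Ioi_self)
    have hwi := intervalIntegrable_of_continuousOn_Ici hw le_rfl hT
    have h := sub_le_integral_of_ae_deriv_le le_rfl hT (hV T hT) (hqi.sub hwi) hd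
    rw [intervalIntegral.integral_sub hqi hwi, intervalIntegral.integral_of_le (f := q) hT] at h
    have h2 : ∫ t in Set.Ioc 0 T, q t ≤ ∫ t in Set.Ioi 0, q t :=
      setIntegral_mono_set hq (Eventually.of_forall hq0) Set.Ioc_subset_Ioi_self.eventuallyLE
    linarith
  refine ⟨⟨V 0 + ∫ t in Set.Ioi 0, q t, fun t ht => ?_⟩, ?_⟩
  · have := key t ht
    have := intervalIntegral.integral_nonneg (μ := volume) ht fun s _ => hw0 s
    linarith
  · refine integrableOn_Ioi_of_intervalIntegral_norm_bounded (V 0 + ∫ t in Set.Ioi 0, q t) 0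
      (l := atTop) (b := id) (fun T => ?_) tendsto_id ?_
    · rcases le_total 0 T with hT | hT
      · exact (intervalIntegrable_iff_integrableOn_Ioc_of_le hT).mp
          (intervalIntegrable_of_continuousOn_Ici hw le_rfl hT)
      · simp [Set.Ioc_eq_empty_of_le hT]
    · filter_upwards [eventually_ge_atTop 0] with T hT
      simp only [Real.norm_of_nonneg (hw0 _), id]
      linarith [key T hT, hV0 T hT]

/-- A Barbalat-type lemma: an integrable nonnegative function whose derivative is bounded above
tends to zero. -/
theorem tendsto_zero_of_integrable_of_ae_deriv_le {U : ℝ → ℝ} {K : ℝ}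
    (hU : ∀ T : ℝ, 0 ≤ T → AbsolutelyContinuousOnInterval U 0 T)
    (hU0 : ∀ t, 0 ≤ U t) (hUi : IntegrableOn U (Set.Ioi 0))
    (hd : ∀ᵐ t ∂(volume.restrict (Set.Ici (0 : ℝ))), ∃ v, HasDerivAt U v t ∧ v ≤ K) :
    Tendsto U atTop (𝓝 0) := by
  -- The window length chosen below is `η / (2 * K)`, which needs a positive slope bound.
  wlog hK : 0 < K generalizing K
  · refine this (K := max K 1) ?_ (by positivity)
    filter_upwards [hd] with t ⟨v, hv, hvK⟩
    exact ⟨v, hv, hvK.trans (le_max_left _ _)⟩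
  have hgrow : ∀ s t, 0 ≤ s → s ≤ t → U t ≤ U s + K * (t - s) := by
    intro s t hs hst
    have h := sub_le_integral_of_ae_deriv_le hs hst (hU t (hs.trans hst))
      (intervalIntegrable_const (c := K)) hd
    rw [intervalIntegral.integral_const, smul_eq_mul] at h
    linarith
  have hc := continuousOn_Ici_of_absolutelyContinuous hU
  -- As `U` rises with slope at most `K`, a value at `t` forces `U` to have been at least `U t - K *
  -- δ` on the whole window before `t`.
  have hmean : ∀ δ > 0, ∀ t, δ ≤ t → δ * U t ≤ (∫ s in (t - δ)..t, U s) + δ * (K * δ) := by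
    intro δ hδ t ht
    have hi := intervalIntegrable_of_continuousOn_Ici hc (a := t - δ) (b := t)
      (by linarith) (by linarith)
    have h : ∫ _ in (t - δ)..t, U t ≤ ∫ s in (t - δ)..t, (U s + K * δ) := by
      refine intervalIntegral.integral_mono_on (by linarith) intervalIntegrable_const
        (hi.add intervalIntegrable_const) fun s hs => ?_
      have := hgrow s t (by linarith [hs.1]) hs.2
      nlinarith [hs.1]
    rw [intervalIntegral.integral_add hi intervalIntegrable_const] at h
    simpa [mul_comm, mul_left_comm] using h
  have htail : ∀ δ > 0, Tendsto (fun t => ∫ s in (t - δ)..t, U s) atTop (𝓝 0) := by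
    intro δ hδ
    have h1 := intervalIntegral_tendsto_integral_Ioi 0 hUi tendsto_id
    have h2 := intervalIntegral_tendsto_integral_Ioi 0 hUi
      (tendsto_atTop_add_const_right atTop (-δ) tendsto_id)
    have h3 := h1.sub h2
    rw [sub_self] at h3
    refine h3.congr' ?_
    filter_upwards [eventually_ge_atTop δ] with t ht
    have ht' : 0 ≤ t + -δ := by linarith
    simp only [id]
    rw [intervalIntegral.integral_interval_sub_left
      (intervalIntegrable_of_continuousOn_Ici hc le_rfl (by linarith))
      (intervalIntegrable_of_continuousOn_Ici hc le_rfl ht'), sub_eq_add_neg]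
  rw [Metric.tendsto_atTop']
  intro η hη
  -- With this window the slope error `K * δ` is `η / 2`; the vanishing integral supplies the other
  -- half.
  set δ := η / (2 * K) with hδ
  have hδ0 : 0 < δ := by positivity
  have hev := (htail δ hδ0).eventually (gt_mem_nhds (show 0 < δ * (η / 2) by positivity))
  obtain ⟨T, hT⟩ := ((hev.and (eventually_ge_atTop δ))).exists_forall_of_atTop
  refine ⟨T, fun t ht => ?_⟩
  obtain ⟨h1, h2⟩ := hT t ht.le
  have h3 := hmean δ hδ0 t h2
  have h4 : K * δ = η / 2 := by rw [hδ]; field_simp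
  rw [h4] at h3
  rw [Real.dist_eq, sub_zero, abs_of_nonneg (hU0 t)]
  have : δ * U t < δ * η := by linarith
  exact lt_of_mul_lt_mul_left this hδ0.le

/-! ### Square-integrable solutions of Hurwitz systems. -/

/-- `g` is continuous, bounded and square integrable on `[0, ∞)`. -/
structure IsBoundedSqIntegrable {F : Type*} [NormedAddCommGroup F] (g : ℝ → F) : Prop where
  continuousOn : ContinuousOn g (Set.Ici 0)
  bounded : ∃ C, ∀ t, 0 ≤ t → ‖g t‖ ≤ C
  integrable : IntegrableOn (fun t => ‖g t‖ ^ 2) (Set.Ioi 0)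

theorem ContinuousOn.integrableOn_Ioi_of_le {f g : ℝ → ℝ} (hf : ContinuousOn f (Set.Ici 0))
    (hg : IntegrableOn g (Set.Ioi 0)) (hf0 : ∀ t, 0 ≤ f t) (hfg : ∀ t, 0 ≤ t → f t ≤ g t) :
    IntegrableOn f (Set.Ioi 0) := by
  refine Integrable.mono' hg
    ((hf.mono Set.Ioi_subset_Ici_self).aestronglyMeasurable measurableSet_Ioi) ?_
  refine (ae_restrict_iff' measurableSet_Ioi).mpr (Eventually.of_forall fun t ht => ?_)
  rw [Real.norm_of_nonneg (hf0 t)]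
  exact hfg t (le_of_lt ht)

theorem norm_add_sq_le_two_mul {F : Type*} [SeminormedAddCommGroup F] (x y : F) :
    ‖x + y‖ ^ 2 ≤ 2 * (‖x‖ ^ 2 + ‖y‖ ^ 2) := by
  have h := norm_add_le x y
  nlinarith [sq_nonneg (‖x‖ - ‖y‖), norm_nonneg (x + y), norm_nonneg x, norm_nonneg y]

namespace IsBoundedSqIntegrable

variable {F : Type*} [NormedAddCommGroup F]

theorem add {f g : ℝ → F} (hf : IsBoundedSqIntegrable f) (hg : IsBoundedSqIntegrable g) :
    IsBoundedSqIntegrable fun t => f t + g t := by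
  obtain ⟨C, hC⟩ := hf.bounded
  obtain ⟨D, hD⟩ := hg.bounded
  refine ⟨hf.continuousOn.add hg.continuousOn, ⟨C + D, fun t ht =>
    (norm_add_le _ _).trans (add_le_add (hC t ht) (hD t ht))⟩, ?_⟩
  exact ((hf.continuousOn.add hg.continuousOn).norm.pow 2).integrableOn_Ioi_of_le
    ((hf.integrable.add hg.integrable).const_mul 2) (fun t => sq_nonneg _)
    fun t _ => norm_add_sq_le_two_mul _ _

theorem const_smul {f : ℝ → F} {𝕜 : Type*} [NormedField 𝕜] [NormedSpace 𝕜 F]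
    (hf : IsBoundedSqIntegrable f) (c : 𝕜) : IsBoundedSqIntegrable fun t => c • f t := by
  obtain ⟨C, hC⟩ := hf.bounded
  refine ⟨hf.continuousOn.const_smul c, ⟨‖c‖ * C, fun t ht => ?_⟩, ?_⟩
  · rw [norm_smul]
    exact mul_le_mul_of_nonneg_left (hC t ht) (norm_nonneg c)
  · simp only [norm_smul, mul_pow]
    exact hf.integrable.const_mul _

theorem zero : IsBoundedSqIntegrable fun _ : ℝ => (0 : F) :=
  ⟨continuousOn_const, ⟨0, fun _ _ => by simp⟩, by simp⟩

/-- A stable scalar linear equation driven by a bounded square-integrable input. -/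
theorem of_scalar_deriv {g p : ℝ → ℂ} {μ : ℂ} (hμ : μ.re < 0)
    (hg : ∀ T : ℝ, 0 ≤ T → AbsolutelyContinuousOnInterval g 0 T)
    (hp : IsBoundedSqIntegrable p)
    (hd : ∀ᵐ t ∂(volume.restrict (Set.Ici (0 : ℝ))), HasDerivAt g (μ * g t + p t) t) :
    IsBoundedSqIntegrable g := by
  have hα : 0 < -μ.re := by linarith
  have hc := continuousOn_Ici_of_absolutelyContinuous hg
  -- Young's inequality with weight `-μ.re` splits the forcing term of `(‖g‖²)'`, so that half of
  -- the damping survives as `w`.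
  obtain ⟨⟨C, hC⟩, hi⟩ := bounded_and_integrable_of_ae_deriv_le (V := fun t => ‖g t‖ ^ 2)
    (q := fun t => (-μ.re)⁻¹ * ‖p t‖ ^ 2) (w := fun t => -μ.re * ‖g t‖ ^ 2)
    (fun T hT => (hg T hT).norm_sq) (fun t _ => sq_nonneg _)
    ((hc.norm.pow 2).const_smul (-μ.re)) (fun t => by positivity) (fun t => by positivity)
    (hp.integrable.const_mul _) (by
      filter_upwards [hd] with t ht
      refine ⟨_, ht.norm_sq, ?_⟩
      have h1 : inner ℝ (g t) (μ * g t) = μ.re * ‖g t‖ ^ 2 := by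
        rw [Complex.inner, Complex.sq_norm, Complex.normSq_apply]
        simp
        ring
      rw [inner_add_right, h1]
      have h2 := real_inner_le_norm (g t) (p t)
      have h3 : 0 ≤ (-μ.re)⁻¹ * ((-μ.re) * ‖g t‖ - ‖p t‖) ^ 2 := by positivity
      have h4 : (-μ.re)⁻¹ * ((-μ.re) * ‖g t‖ - ‖p t‖) ^ 2
          = (-μ.re) * ‖g t‖ ^ 2 - 2 * (‖g t‖ * ‖p t‖) + (-μ.re)⁻¹ * ‖p t‖ ^ 2 := by
        have := hμ.ne
        field_simp
        ring
      linarith)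
  refine ⟨hc, ⟨C + 1, fun t ht => ?_⟩, ?_⟩
  · nlinarith [hC t ht, sq_nonneg (‖g t‖ - 1)]
  · have h := hi.const_mul (-μ.re)⁻¹
    simpa [← mul_assoc, inv_mul_cancel₀ hμ.ne] using! h

end IsBoundedSqIntegrable

/-- The solutions of a linear equation with a Hurwitz matrix are bounded and square
integrable. -/
theorem HeteroMAS.IsHurwitz.isBoundedSqIntegrable {n : ℕ} {M : Matrix (Fin n) (Fin n) ℝ}
    (hM : HeteroMAS.IsHurwitz M) {f : ℝ → EuclideanSpace ℝ (Fin n)}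
    (hf : HeteroMAS.IsSolution f fun t => {M.toEuclideanLin (f t)}) :
    IsBoundedSqIntegrable f := by
  set Mc : Matrix (Fin n) (Fin n) ℂ := M.map (algebraMap ℝ ℂ) with hMc
  let y : ℝ → Fin n → ℂ := fun t k => (f t k : ℂ)
  -- Testing the solution against a covector `c` moves the dynamics onto `c`: the derivative of `g
  -- c` is `g (T c)`, with `T` the transposed matrix.
  let g : (Fin n → ℂ) → ℝ → ℂ := fun c t => c ⬝ᵥ y t
  let T : Module.End ℂ (Fin n → ℂ) := Matrix.toLin' Mc.transpose
  have hyac : ∀ k, ∀ b : ℝ, 0 ≤ b → AbsolutelyContinuousOnInterval (fun t => y t k) 0 b := by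
    intro k b hb
    have h1 : AbsolutelyContinuousOnInterval (fun t => f t k) 0 b :=
      (hf.ac b hb).lipschitz_comp (EuclideanSpace.proj (𝕜 := ℝ) k).lipschitz
    exact h1.lipschitz_comp Complex.ofRealCLM.lipschitz
  have hgac : ∀ c, ∀ b : ℝ, 0 ≤ b → AbsolutelyContinuousOnInterval (g c) 0 b := by
    intro c b hb
    exact AbsolutelyContinuousOnInterval.fun_finset_sum _ fun k _ => (hyac k b hb).const_smul (c k)
  have hgd : ∀ c, ∀ᵐ t ∂(volume.restrict (Set.Ici (0 : ℝ))), HasDerivAt (g c) (g (T c) t) t := by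
    intro c
    filter_upwards [hf.deriv] with t ⟨v, hv, hvd⟩
    rw [Set.mem_singleton_iff] at hv
    subst hv
    have h1 : ∀ k, HasDerivAt (fun s => y s k) ((Mc.mulVec (y t)) k) t := by
      intro k
      have h2 : HasDerivAt (fun s => f s k) ((M.toEuclideanLin (f t)) k) t :=
        (EuclideanSpace.proj (𝕜 := ℝ) k).hasFDerivAt.comp_hasDerivAt t hvd
      convert! h2.ofReal_comp using 1
      simp [Matrix.mulVec, dotProduct, hMc, y]
    have h3 : HasDerivAt (g c) (∑ k, c k * (Mc.mulVec (y t)) k) t :=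
      HasDerivAt.fun_sum fun k _ => (h1 k).const_mul (c k)
    have h4 : g (T c) t = ∑ k, c k * (Mc.mulVec (y t)) k := by
      change (Matrix.toLin' Mc.transpose c) ⬝ᵥ y t = c ⬝ᵥ (Mc.mulVec (y t))
      rw [Matrix.toLin'_apply, Matrix.mulVec_transpose, Matrix.dotProduct_mulVec]
    rwa [h4]
  -- It suffices that the good covectors contain every generalized eigenspace of `T`, since these
  -- span over `ℂ`. This avoids both the matrix exponential and the Lyapunov equation.
  let S : Submodule ℂ (Fin n → ℂ) :=
    { carrier := {c | IsBoundedSqIntegrable (g c)}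
      add_mem' := fun {c d} hc hd => by
        have h := IsBoundedSqIntegrable.add hc hd
        simpa only [g, ← add_dotProduct] using! h
      zero_mem' := by
        change IsBoundedSqIntegrable (g 0)
        simpa [g] using! IsBoundedSqIntegrable.zero
      smul_mem' := fun a c hc => by
        have h := IsBoundedSqIntegrable.const_smul hc a
        simpa only [g, ← smul_dotProduct] using! h }
  have hgen : ∀ μ : ℂ, ∀ k : ℕ, T.genEigenspace μ k ≤ S := by
    intro μ k
    induction k with
    | zero => simp
    | succ k ih =>
      intro c hc
      by_cases hc0 : c = 0
      · rw [hc0]; exact S.zero_mem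
      have hne : T.genEigenspace μ ((k + 1 : ℕ) : ℕ∞) ≠ ⊥ := by
        intro h
        rw [h] at hc
        exact hc0 hc
      have hev : T.HasEigenvalue μ := Module.End.HasUnifEigenvalue.lt zero_lt_one hne
      have hμ : μ.re < 0 := by
        refine hM μ ?_
        have h := Module.End.hasEigenvalue_iff_mem_spectrum.mp hev
        rw [Matrix.spectrum_toLin'] at h
        rw [spectrum.mem_iff, Matrix.isUnit_iff_isUnit_det] at h ⊢
        convert! h using 2
        rw [← Matrix.det_transpose]
        congr 1
        simp [Matrix.transpose_sub, Matrix.algebraMap_eq_diagonal, hMc]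
      have hd : (T - μ • 1) c ∈ S := by
        refine ih ?_
        rw [Module.End.mem_genEigenspace_nat, LinearMap.mem_ker] at hc ⊢
        rw [pow_succ] at hc
        exact hc
      -- On a Jordan chain, `g c` solves a stable scalar equation forced by the next lower member,
      -- already good by induction.
      refine IsBoundedSqIntegrable.of_scalar_deriv (p := g ((T - μ • 1) c)) hμ (hgac c) hd ?_
      filter_upwards [hgd c] with t ht
      convert! ht using 1
      change μ * (c ⬝ᵥ y t) + ((T - μ • 1) c) ⬝ᵥ y t = (T c) ⬝ᵥ y t
      have : T c = μ • c + (T - μ • 1) c := by simp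
      conv_rhs => rw [this, add_dotProduct, smul_dotProduct, smul_eq_mul]
  have htop : S = ⊤ := by
    rw [eq_top_iff, ← Module.End.iSup_maxGenEigenspace_eq_top T]
    refine iSup_le fun μ => ?_
    rw [Module.End.maxGenEigenspace_eq_genEigenspace_finrank]
    exact hgen μ _
  have hk : ∀ k, IsBoundedSqIntegrable fun t => f t k := by
    intro k
    have h : IsBoundedSqIntegrable (g (Pi.single k 1)) := by
      change Pi.single k 1 ∈ S
      rw [htop]; trivial
    have hnorm : ∀ t, ‖g (Pi.single k 1) t‖ = ‖f t k‖ := fun t => by simp [g, y]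
    obtain ⟨C, hC⟩ := h.bounded
    refine ⟨?_, ⟨C, fun t ht => (hnorm t).symm.trans_le (hC t ht)⟩, ?_⟩
    · exact (EuclideanSpace.proj (𝕜 := ℝ) k).continuous.comp_continuousOn
        (continuousOn_Ici_of_absolutelyContinuous hf.ac)
    · simpa only [hnorm] using h.integrable
  have hsq : ∀ t, ‖f t‖ ^ 2 = ∑ k, ‖f t k‖ ^ 2 := fun t => EuclideanSpace.norm_sq_eq _
  choose C hC using fun k => (hk k).bounded
  refine ⟨continuousOn_Ici_of_absolutelyContinuous hf.ac, ⟨(∑ k, C k ^ 2) + 1, fun t ht => ?_⟩, ?_⟩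
  · have h1 : ‖f t‖ ^ 2 ≤ ∑ k, C k ^ 2 := by
      rw [hsq]
      exact Finset.sum_le_sum fun k _ => pow_le_pow_left₀ (norm_nonneg _) (hC k t ht) 2
    nlinarith [sq_nonneg (‖f t‖ - 1)]
  · simp only [hsq]
    exact integrable_finsetSum _ fun k _ => (hk k).integrable

/-! ### Quadratic forms and the graph Laplacian. -/

/-- A positive definite continuous quadratic function on a finite-dimensional space is
coercive. -/
theorem exists_norm_sq_le_of_homogeneous {F : Type*} [NormedAddCommGroup F] [NormedSpace ℝ F]
    [FiniteDimensional ℝ F] {q : F → ℝ} (hq : Continuous q)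
    (hsmul : ∀ (c : ℝ) x, q (c • x) = c ^ 2 * q x) (hq0 : ∀ x, 0 ≤ q x)
    (hpos : ∀ x, q x = 0 → x = 0) : ∃ C, 0 ≤ C ∧ ∀ x, ‖x‖ ^ 2 ≤ C * q x := by
  rcases subsingleton_or_nontrivial F with h | h
  · refine ⟨0, le_rfl, fun x => ?_⟩
    simp [Subsingleton.elim x 0]
  -- The unit sphere is compact, and homogeneity transports its minimum to the whole space.
  obtain ⟨x₀, hx₀, hmin⟩ := (isCompact_sphere (0 : F) 1).exists_isMinOn
    (NormedSpace.sphere_nonempty.mpr zero_le_one) hq.continuousOn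
  have hm : 0 < q x₀ := by
    refine lt_of_le_of_ne (hq0 _) fun h0 => ?_
    rw [hpos x₀ h0.symm] at hx₀
    simp at hx₀
  refine ⟨(q x₀)⁻¹, by positivity, fun x => ?_⟩
  rcases eq_or_ne x 0 with rfl | hx
  · have := hq0 0
    rw [norm_zero, zero_pow two_ne_zero]
    positivity
  · have hxn : ‖x‖ ≠ 0 := norm_ne_zero_iff.mpr hx
    have h1 : q x₀ ≤ q (‖x‖⁻¹ • x) := by
      refine hmin ?_
      simp [norm_smul, hxn]
    have h2 : q x = ‖x‖ ^ 2 * q (‖x‖⁻¹ • x) := by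
      rw [hsmul]
      field_simp
    rw [h2, inv_mul_eq_div, le_div_iff₀ hm]
    exact mul_le_mul_of_nonneg_left h1 (sq_nonneg _)

/-- A sum of inner products of continuous linear maps is a bounded quadratic form. -/
theorem exists_sum_inner_le {F κ : Type*} [NormedAddCommGroup F] [NormedSpace ℝ F] [Fintype κ]
    {G : κ → Type*} [∀ k, NormedAddCommGroup (G k)] [∀ k, InnerProductSpace ℝ (G k)]
    (P Q : ∀ k, F →L[ℝ] G k) :
    ∃ K, 0 ≤ K ∧ ∀ x, ∑ k, inner ℝ (P k x) (Q k x) ≤ K * ‖x‖ ^ 2 := by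
  refine ⟨∑ k, ‖P k‖ * ‖Q k‖, by positivity, fun x => ?_⟩
  rw [Finset.sum_mul]
  refine Finset.sum_le_sum fun k _ => (real_inner_le_norm _ _).trans ?_
  calc ‖P k x‖ * ‖Q k x‖ ≤ (‖P k‖ * ‖x‖) * (‖Q k‖ * ‖x‖) :=
        mul_le_mul ((P k).le_opNorm x) ((Q k).le_opNorm x) (norm_nonneg _) (by positivity)
    _ = _ := by ring

section Laplacian

variable {ι E : Type*} [Fintype ι] [NormedAddCommGroup E] [InnerProductSpace ℝ E]

/-- The weighted graph Laplacian, acting on families of vectors. -/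
noncomputable def laplacianCLM (E : Type*) [NormedAddCommGroup E] [InnerProductSpace ℝ E]
    (a : ι → ι → ℝ) (i : ι) : (ι → E) →L[ℝ] E :=
  ∑ j, a i j • (ContinuousLinearMap.proj (R := ℝ) (φ := fun _ : ι => E) i
    - ContinuousLinearMap.proj (R := ℝ) (φ := fun _ : ι => E) j)

theorem laplacianCLM_apply (a : ι → ι → ℝ) (i : ι) (e : ι → E) :
    laplacianCLM E a i e = ∑ j, a i j • (e i - e j) := by
  simp [laplacianCLM]

/-- Summation by parts: exchanging `i` and `j` flips the sign of `e i - e j`, and averaging the two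
forms gives the factor one half. -/
theorem sum_inner_laplacianCLM {a : ι → ι → ℝ} (ha : ∀ i j, a i j = a j i) (e f : ι → E) :
    ∑ i, inner ℝ (laplacianCLM E a i e) (f i)
      = (∑ i, ∑ j, a i j * inner ℝ (e i - e j) (f i - f j)) / 2 := by
  have h1 : ∑ i, inner ℝ (laplacianCLM E a i e) (f i)
      = ∑ i, ∑ j, a i j * inner ℝ (e i - e j) (f i) := by
    refine Finset.sum_congr rfl fun i _ => ?_
    rw [laplacianCLM_apply, sum_inner]
    exact Finset.sum_congr rfl fun j _ => real_inner_smul_left _ _ _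
  have h2 : ∑ i, ∑ j, a i j * inner ℝ (e i - e j) (f i)
      = ∑ i, ∑ j, -(a i j * inner ℝ (e i - e j) (f j)) := by
    rw [Finset.sum_comm]
    refine Finset.sum_congr rfl fun i _ => Finset.sum_congr rfl fun j _ => ?_
    rw [ha j i, ← neg_sub (e i) (e j), inner_neg_left]
    ring
  have h3 : ∑ i, ∑ j, a i j * inner ℝ (e i - e j) (f i - f j)
      = ∑ i, ∑ j, a i j * inner ℝ (e i - e j) (f i)
        + ∑ i, ∑ j, -(a i j * inner ℝ (e i - e j) (f j)) := by
    simp only [← Finset.sum_add_distrib]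
    refine Finset.sum_congr rfl fun i _ => Finset.sum_congr rfl fun j _ => ?_
    rw [inner_sub_right]
    ring
  rw [h1, h3, ← h2]
  ring

theorem sum_inner_laplacianCLM_self_nonneg {a : ι → ι → ℝ} (ha : ∀ i j, a i j = a j i)
    (ha0 : ∀ i j, 0 ≤ a i j) (e : ι → E) : 0 ≤ ∑ i, inner ℝ (laplacianCLM E a i e) (e i) := by
  rw [sum_inner_laplacianCLM ha]
  refine div_nonneg (Finset.sum_nonneg fun i _ => Finset.sum_nonneg fun j _ => ?_) zero_le_two
  exact mul_nonneg (ha0 i j) real_inner_self_nonneg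

theorem eq_of_sum_inner_laplacianCLM_self_eq_zero {a : ι → ι → ℝ} (ha : ∀ i j, a i j = a j i)
    (ha0 : ∀ i j, 0 ≤ a i j) {e : ι → E}
    (h : ∑ i, inner ℝ (laplacianCLM E a i e) (e i) = 0) {i j : ι} (hij : a i j ≠ 0) :
    e i = e j := by
  have hnn : ∀ i j, 0 ≤ a i j * inner ℝ (e i - e j) (e i - e j) := fun i j =>
    mul_nonneg (ha0 i j) real_inner_self_nonneg
  rw [sum_inner_laplacianCLM ha, div_eq_zero_iff, or_iff_left two_ne_zero,
    Finset.sum_eq_zero_iff_of_nonneg fun i _ => Finset.sum_nonneg fun j _ => hnn i j] at h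
  have h1 := h i (Finset.mem_univ _)
  rw [Finset.sum_eq_zero_iff_of_nonneg fun j _ => hnn i j] at h1
  have h2 := (mul_eq_zero.mp (h1 j (Finset.mem_univ _))).resolve_left hij
  exact sub_eq_zero.mp (inner_self_eq_zero.mp h2)

/-- The Laplacian is self-adjoint, so the two product-rule terms agree and absorb the division by
two. -/
theorem hasDerivAt_sum_inner_laplacianCLM {a : ι → ι → ℝ} (ha : ∀ i j, a i j = a j i)
    {e : ι → ℝ → E} {e' : ι → E} {t : ℝ} (h : ∀ i, HasDerivAt (e i) (e' i) t) :
    HasDerivAt (fun s => (∑ i, inner ℝ (laplacianCLM E a i fun j => e j s) (e i s)) / 2)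
      (∑ i, inner ℝ (laplacianCLM E a i fun j => e j t) (e' i)) t := by
  have hpi : HasDerivAt (fun s j => e j s) e' t := hasDerivAt_pi.mpr h
  have h1 : HasDerivAt (fun s => ∑ i, inner ℝ (laplacianCLM E a i fun j => e j s) (e i s))
      (∑ i, (inner ℝ (laplacianCLM E a i fun j => e j t) (e' i)
        + inner ℝ (laplacianCLM E a i e') (e i t))) t :=
    HasDerivAt.fun_sum fun i _ =>
      ((laplacianCLM E a i).hasFDerivAt.comp_hasDerivAt t hpi).inner ℝ (h i)
  convert! h1.div_const 2 using 1
  have h2 : ∑ i, inner ℝ (laplacianCLM E a i e') (e i t)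
      = ∑ i, inner ℝ (laplacianCLM E a i fun j => e j t) (e' i) := by
    rw [sum_inner_laplacianCLM ha, sum_inner_laplacianCLM ha]
    simp only [real_inner_comm]
  rw [Finset.sum_add_distrib, h2]
  ring

end Laplacian

theorem abs_le_add_one_of_sq_le {x c : ℝ} (h : x ^ 2 ≤ c) : |x| ≤ c + 1 := by
  nlinarith [sq_nonneg (|x| - 1), sq_abs x]

/-- The weight `2 * φ` cancels the adaptation step size, so the gain's contribution to the Lyapunov
derivative is free of `φ`. -/
theorem HasDerivAt.sub_sq_div_two_mul {γ : ℝ → ℝ} {φ z t : ℝ} (hφ : 0 < φ)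
    (h : HasDerivAt γ (φ * z) t) (c : ℝ) :
    HasDerivAt (fun s => (γ s - c) ^ 2 / (2 * φ)) ((γ t - c) * z) t := by
  convert! ((h.sub_const c).fun_pow 2).div_const (2 * φ) using 1
  field_simp
  simp only [Nat.cast_ofNat, Nat.add_one_sub_one, pow_one]
  ring

/-! ### Lyapunov analysis of the error in abstract form. -/

section ErrorDynamics

variable {ι E : Type*} [Fintype ι] [NormedAddCommGroup E] [InnerProductSpace ℝ E]
  {D U : ι → Type*} [∀ i, NormedAddCommGroup (D i)] [∀ i, InnerProductSpace ℝ (D i)]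
  [∀ i, NormedAddCommGroup (U i)] [∀ i, InnerProductSpace ℝ (U i)]

/-- A connected weighted network in which agent `i` splits the state space orthogonally into
coordinates `td i` that it detects and coordinates `tu i` that it does not, such that every state
is detected jointly. -/
structure IsJointlyDetecting (a : ι → ι → ℝ) (td : ∀ i, E →L[ℝ] D i) (tu : ∀ i, E →L[ℝ] U i) :
    Prop where
  symm : ∀ i j, a i j = a j i
  nonneg : ∀ i j, 0 ≤ a i j
  consensus : ∀ e : ι → E, (∀ i j, a i j ≠ 0 → e i = e j) → ∀ i j, e i = e j
  inner_eq : ∀ i z w, inner ℝ z w = inner ℝ (td i z) (td i w) + inner ℝ (tu i z) (tu i w)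
  eq_zero : ∀ w, (∀ i, td i w = 0) → w = 0

variable {a : ι → ι → ℝ} {td : ∀ i, E →L[ℝ] D i} {tu : ∀ i, E →L[ℝ] U i}

namespace IsJointlyDetecting

theorem eq_zero_of_laplacian (hN : IsJointlyDetecting a td tu) {e : ι → E}
    (h : ∑ i, inner ℝ (laplacianCLM E a i e) (e i) = 0) (hd : ∀ i, td i (e i) = 0) : e = 0 := by
  have hc := hN.consensus e fun i j hij =>
    eq_of_sum_inner_laplacianCLM_self_eq_zero hN.symm hN.nonneg h hij
  ext1 i
  refine hN.eq_zero _ fun j => ?_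
  rw [hc i j]
  exact hd j

/-- When the right side vanishes, each `inner (laplacianCLM E a i e) (e i)` splits into an own and a
non-own product, each with a zero factor; `eq_zero_of_laplacian` then gives definiteness. -/
theorem exists_norm_sq_le_disagreement [FiniteDimensional ℝ E]
    (hN : IsJointlyDetecting a td tu) :
    ∃ C, 0 ≤ C ∧ ∀ e : ι → E, ‖e‖ ^ 2 ≤
      C * (∑ i, ‖tu i (laplacianCLM E a i e)‖ ^ 2 + ∑ i, ‖td i (e i)‖ ^ 2) := by
  refine exists_norm_sq_le_of_homogeneous (by fun_prop) (fun c x => ?_) (fun x => by positivity)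
    fun x hx => ?_
  · simp only [map_smul, Pi.smul_apply, norm_smul, mul_pow, ← Finset.mul_sum, Real.norm_eq_abs,
      sq_abs, mul_add]
  · rw [add_eq_zero_iff_of_nonneg (by positivity) (by positivity),
      Finset.sum_eq_zero_iff_of_nonneg fun i _ => by positivity,
      Finset.sum_eq_zero_iff_of_nonneg fun i _ => by positivity] at hx
    have h1 : ∀ i, tu i (laplacianCLM E a i x) = 0 := fun i => by simpa using hx.1 i
    have h2 : ∀ i, td i (x i) = 0 := fun i => by simpa using hx.2 i
    refine hN.eq_zero_of_laplacian (Finset.sum_eq_zero fun i _ => ?_) h2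
    rw [hN.inner_eq i, h1, h2, inner_zero_left, inner_zero_right, add_zero]

/-- Turns a bound on the Lyapunov function, together with one on the own errors, into a bound on the
full error. -/
theorem exists_norm_sq_le_energy [FiniteDimensional ℝ E] (hN : IsJointlyDetecting a td tu) :
    ∃ C, 0 ≤ C ∧ ∀ e : ι → E, ‖e‖ ^ 2 ≤
      C * ((∑ i, inner ℝ (laplacianCLM E a i e) (e i)) / 2 + ∑ i, ‖td i (e i)‖ ^ 2) := by
  have hnn := fun e : ι → E => sum_inner_laplacianCLM_self_nonneg hN.symm hN.nonneg e
  refine exists_norm_sq_le_of_homogeneous (by fun_prop) (fun c x => ?_)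
    (fun x => add_nonneg (div_nonneg (hnn x) zero_le_two) (by positivity)) fun x hx => ?_
  · simp only [map_smul, Pi.smul_apply, norm_smul, mul_pow, ← Finset.mul_sum, Real.norm_eq_abs,
      sq_abs, mul_add, real_inner_smul_left, real_inner_smul_right]
    ring
  · rw [add_eq_zero_iff_of_nonneg (div_nonneg (hnn x) zero_le_two) (by positivity),
      Finset.sum_eq_zero_iff_of_nonneg fun i _ => by positivity] at hx
    refine hN.eq_zero_of_laplacian ?_ fun i => ?_
    · linarith [hx.1]
    · simpa using hx.2 i

/-- The adaptive observer error converges to zero and the adaptive gains stay bounded. -/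
theorem tendsto_zero_and_bounded [FiniteDimensional ℝ E] (hN : IsJointlyDetecting a td tu)
    (H : ∀ i, D i →L[ℝ] D i) (A : E →L[ℝ] E) {b : ℝ} {φ φs : ι → ℝ} (hφ : ∀ i, 0 < φ i)
    (hφs : ∀ i, 0 < φs i) {e : ι → ℝ → E} {γ γs : ι → ℝ → ℝ}
    (he_ac : ∀ i, ∀ T : ℝ, 0 ≤ T → AbsolutelyContinuousOnInterval (e i) 0 T)
    (he_deriv : ∀ i, ∀ᵐ t ∂(volume.restrict (Set.Ici (0 : ℝ))), ∃ e' r v,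
      HasDerivAt (e i) e' t ∧ td i e' = H i (td i (e i t)) ∧ ‖r‖ ≤ b ∧ ‖v‖ ≤ 1 ∧
      inner ℝ (tu i (laplacianCLM E a i fun j => e j t)) v
        = ‖tu i (laplacianCLM E a i fun j => e j t)‖ ∧
      tu i e' = tu i (A (e i t)) - r - γ i t • tu i (laplacianCLM E a i fun j => e j t)
        - γs i t • v)
    (hγ : ∀ i, HeteroMAS.IsSolution (γ i) fun t =>
      {φ i * ‖tu i (laplacianCLM E a i fun j => e j t)‖ ^ 2})
    (hγs : ∀ i, HeteroMAS.IsSolution (γs i) fun t =>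
      {φs i * ‖tu i (laplacianCLM E a i fun j => e j t)‖})
    (hd : ∀ i, IsBoundedSqIntegrable fun t => td i (e i t)) :
    (∀ i, Tendsto (fun t => ‖e i t‖) atTop (𝓝 0)) ∧
    ∀ i, ∃ c : ℝ, ∀ t : ℝ, 0 ≤ t → |γ i t| ≤ c ∧ |γs i t| ≤ c := by
  set ε : ∀ i, ℝ → U i := fun i t => tu i (laplacianCLM E a i fun j => e j t) with hε
  obtain ⟨C₁, hC₁, hdis⟩ := hN.exists_norm_sq_le_disagreement
  obtain ⟨C₂, hC₂, hen⟩ := hN.exists_norm_sq_le_energy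
  let pr : ∀ i : ι, (ι → E) →L[ℝ] E := fun i => ContinuousLinearMap.proj i
  obtain ⟨K₁, hK₁, hK₁'⟩ := exists_sum_inner_le (fun i => (td i).comp (laplacianCLM E a i))
    fun i => (H i).comp ((td i).comp (pr i))
  obtain ⟨K₂, hK₂, hK₂'⟩ := exists_sum_inner_le (fun i => (tu i).comp (laplacianCLM E a i))
    fun i => (tu i).comp (A.comp (pr i))
  -- The cross terms are at most `(K₁ + K₂) * ‖e‖ ^ 2`; the disagreement inequality converts this to
  -- `κ` times the sum of `‖ε i‖ ^ 2` and the squared own errors.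
  set κ := (K₁ + K₂) * C₁ with hκ
  have hκ0 : 0 ≤ κ := by positivity
  have hec : ContinuousOn (fun t j => e j t) (Set.Ici 0) :=
    continuousOn_pi.mpr fun i => continuousOn_Ici_of_absolutelyContinuous (he_ac i)
  have hεc : ∀ i, ContinuousOn (ε i) (Set.Ici 0) := fun i =>
    ((tu i).comp (laplacianCLM E a i)).continuous.comp_continuousOn hec
  have he_ac' : ∀ i, ∀ T : ℝ, 0 ≤ T →
      AbsolutelyContinuousOnInterval (fun t => laplacianCLM E a i fun j => e j t) 0 T := by
    intro i T hT
    simp only [laplacianCLM_apply]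
    exact AbsolutelyContinuousOnInterval.fun_finset_sum _ fun j _ =>
      ((he_ac i T hT).fun_sub (he_ac j T hT)).const_smul (a i j)
  let W : ℝ → ℝ := fun t => (∑ i, inner ℝ (laplacianCLM E a i fun j => e j t) (e i t)) / 2
  have hW0 : ∀ t, 0 ≤ W t := fun t =>
    div_nonneg (sum_inner_laplacianCLM_self_nonneg hN.symm hN.nonneg _) zero_le_two
  let g : ι → ℝ → ℝ := fun i t =>
    (γ i t - (κ + 1)) ^ 2 / (2 * φ i) + (γs i t - b) ^ 2 / (2 * φs i)
  have hg0 : ∀ i t, 0 ≤ g i t := fun i t => by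
    have := hφ i
    have := hφs i
    positivity
  have hV_ac : ∀ T : ℝ, 0 ≤ T → AbsolutelyContinuousOnInterval (fun t => W t + ∑ i, g i t) 0 T := by
    intro T hT
    have hsq : ∀ (f : ℝ → ℝ) (c k : ℝ), AbsolutelyContinuousOnInterval f 0 T →
        AbsolutelyContinuousOnInterval (fun t => (f t - c) ^ 2 / k) 0 T := by
      intro f c k hf
      have h := (hf.fun_sub (AbsolutelyContinuousOnInterval.const c 0 T)).norm_sq.const_mul k⁻¹
      simpa only [Real.norm_eq_abs, sq_abs, inv_mul_eq_div] using h
    refine AbsolutelyContinuousOnInterval.fun_add ?_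
      (AbsolutelyContinuousOnInterval.fun_finset_sum _ fun i _ =>
        (hsq _ _ _ ((hγ i).ac T hT)).fun_add (hsq _ _ _ ((hγs i).ac T hT)))
    have h := (AbsolutelyContinuousOnInterval.fun_finset_sum Finset.univ fun i _ =>
      (he_ac' i T hT).fun_inner (he_ac i T hT)).const_mul (2 : ℝ)⁻¹
    simpa only [W, inv_mul_eq_div] using h
  have hV_deriv : ∀ᵐ t ∂(volume.restrict (Set.Ici (0 : ℝ))), ∃ v,
      HasDerivAt (fun t => W t + ∑ i, g i t) v t ∧
        v ≤ κ * ∑ i, ‖td i (e i t)‖ ^ 2 - ∑ i, ‖ε i t‖ ^ 2 := by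
    filter_upwards [ae_all_iff.mpr he_deriv, ae_all_iff.mpr fun i => (hγ i).deriv,
      ae_all_iff.mpr fun i => (hγs i).deriv] with t het hγt hγst
    choose e' r v he' htd hr hv hεv htu using het
    have hγt' : ∀ i, HasDerivAt (γ i) (φ i * ‖ε i t‖ ^ 2) t := fun i => by
      obtain ⟨w, hw, hwd⟩ := hγt i
      rwa [Set.mem_singleton_iff.mp hw] at hwd
    have hγst' : ∀ i, HasDerivAt (γs i) (φs i * ‖ε i t‖) t := fun i => by
      obtain ⟨w, hw, hwd⟩ := hγst i
      rwa [Set.mem_singleton_iff.mp hw] at hwd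
    refine ⟨_, (hasDerivAt_sum_inner_laplacianCLM hN.symm he').add
      (HasDerivAt.fun_sum fun i _ => ((hγt' i).sub_sq_div_two_mul (hφ i) (κ + 1)).add
        ((hγst' i).sub_sq_div_two_mul (hφs i) b)), ?_⟩
    -- The terms in `γ i t` and `γs i t` cancel exactly, leaving the targets; the one at `b` absorbs
    -- the input `r`.
    have hagent : ∀ i, inner ℝ (laplacianCLM E a i fun j => e j t) (e' i)
        + ((γ i t - (κ + 1)) * ‖ε i t‖ ^ 2 + (γs i t - b) * ‖ε i t‖)
        ≤ inner ℝ (td i (laplacianCLM E a i fun j => e j t)) (H i (td i (e i t)))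
          + inner ℝ (ε i t) (tu i (A (e i t))) - (κ + 1) * ‖ε i t‖ ^ 2 := by
      intro i
      rw [hN.inner_eq i, htd, htu]
      change _ + inner ℝ (ε i t) _ + _ ≤ _
      have h1 : inner ℝ (ε i t) (γ i t • ε i t) = γ i t * ‖ε i t‖ ^ 2 := by
        rw [real_inner_smul_right, real_inner_self_eq_norm_sq]
      have h2 : inner ℝ (ε i t) (γs i t • v i) = γs i t * ‖ε i t‖ := by
        rw [real_inner_smul_right, hεv]
      have h3 : -inner ℝ (ε i t) (r i) ≤ ‖ε i t‖ * b :=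
        ((neg_le_abs _).trans (abs_real_inner_le_norm _ _)).trans
          (mul_le_mul_of_nonneg_left (hr i) (norm_nonneg _))
      rw [inner_sub_right, inner_sub_right, inner_sub_right, h1, h2]
      linarith
    have hsum := Finset.sum_le_sum fun i (_ : i ∈ Finset.univ) => hagent i
    simp only [Finset.sum_sub_distrib, Finset.sum_add_distrib, ← Finset.mul_sum] at hsum ⊢
    have h1 := hK₁' fun j => e j t
    have h2 := hK₂' fun j => e j t
    have h3 := mul_le_mul_of_nonneg_left (hdis fun j => e j t) (add_nonneg hK₁ hK₂)
    simp only [ContinuousLinearMap.comp_apply, pr, ContinuousLinearMap.proj_apply] at h1 h2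
    rw [← mul_assoc, ← hκ, mul_add] at h3
    have h4 : ∑ i, inner ℝ (ε i t) (tu i (A (e i t))) ≤ K₂ * ‖fun j => e j t‖ ^ 2 := h2
    have h5 : (K₁ + K₂) * ‖fun j => e j t‖ ^ 2 ≤
      κ * ∑ i, ‖ε i t‖ ^ 2 + κ * ∑ i, ‖td i (e i t)‖ ^ 2 := h3
    linarith
  have hdi : IntegrableOn (fun t => ∑ i, ‖td i (e i t)‖ ^ 2) (Set.Ioi 0) :=
    integrable_finsetSum _ fun i _ => (hd i).integrable
  obtain ⟨⟨CV, hCV⟩, hεi⟩ := bounded_and_integrable_of_ae_deriv_le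
    (q := fun t => κ * ∑ i, ‖td i (e i t)‖ ^ 2) (w := fun t => ∑ i, ‖ε i t‖ ^ 2) hV_ac
    (fun t _ => add_nonneg (hW0 t) (Finset.sum_nonneg fun i _ => hg0 i t))
    (continuousOn_finsetSum _ fun i _ => (hεc i).norm.pow 2) (fun t => by positivity)
    (fun t => by positivity) (hdi.const_mul κ) hV_deriv
  have hgC : ∀ i t, 0 ≤ t → g i t ≤ CV := fun i t ht => by
    have h1 := hCV t ht
    have h2 := Finset.single_le_sum (fun j _ => hg0 j t) (Finset.mem_univ i)
    linarith [hW0 t]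
  have hgain : ∀ (f : ℝ → ℝ) (c k : ℝ), 0 < k → (∀ t, 0 ≤ t → (f t - c) ^ 2 / (2 * k) ≤ CV) →
      ∀ t, 0 ≤ t → |f t| ≤ |c| + (CV * (2 * k) + 1) := by
    intro f c k hk h t ht
    have h1 := abs_le_add_one_of_sq_le ((div_le_iff₀ (by positivity)).mp (h t ht))
    have h2 := abs_add_le (f t - c) c
    rw [sub_add_cancel] at h2
    linarith
  have hbound : ∀ i, ∃ c : ℝ, ∀ t : ℝ, 0 ≤ t → |γ i t| ≤ c ∧ |γs i t| ≤ c := by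
    intro i
    have hi := hφ i
    have hsi := hφs i
    refine ⟨max _ _, fun t ht => ⟨(hgain (γ i) (κ + 1) (φ i) hi (fun s hs => ?_) t ht).trans
      (le_max_left _ _), (hgain (γs i) b (φs i) hsi (fun s hs => ?_) t ht).trans
      (le_max_right _ _)⟩⟩
    · exact le_trans (le_add_of_nonneg_right (by positivity)) (hgC i s hs)
    · exact le_trans (le_add_of_nonneg_left (by positivity)) (hgC i s hs)
  choose Cd hCd using fun i => (hd i).bounded
  obtain ⟨R, hR⟩ : ∃ R, ∀ t, 0 ≤ t → ‖fun j => e j t‖ ≤ R := by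
    refine ⟨C₂ * (CV + ∑ i, Cd i ^ 2) + 1, fun t ht => ?_⟩
    rw [← abs_of_nonneg (norm_nonneg _)]
    refine abs_le_add_one_of_sq_le ((hen fun j => e j t).trans
      (mul_le_mul_of_nonneg_left (add_le_add ?_ ?_) hC₂))
    · have h1 := hCV t ht
      have h2 := Finset.sum_nonneg fun i (_ : i ∈ Finset.univ) => hg0 i t
      change W t ≤ CV
      linarith
    · exact Finset.sum_le_sum fun i _ => pow_le_pow_left₀ (norm_nonneg _) (hCd i t ht) 2
  refine ⟨fun i => ?_, hbound⟩
  obtain ⟨c, hc⟩ := hbound i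
  have hRi : ∀ t, 0 ≤ t → ‖e i t‖ ≤ R := fun t ht =>
    (norm_le_pi_norm (fun j => e j t) i).trans (hR t ht)
  have hlim : Tendsto (fun t => ‖e i t‖ ^ 2) atTop (𝓝 0) := by
    -- `K` bounds the derivative `2 * inner (e i t) e'` after splitting it into own and non-own
    -- parts, using the bounds on the errors, inputs and gains.
    refine tendsto_zero_of_integrable_of_ae_deriv_le
      (K := 2 * (Cd i * (‖H i‖ * Cd i) + ‖tu i‖ * R * (‖(tu i).comp A‖ * R + b
        + c * (‖(tu i).comp (laplacianCLM E a i)‖ * R) + c * 1)))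
      (fun T hT => (he_ac i T hT).norm_sq) (fun t => sq_nonneg _) ?_ ?_
    · refine ContinuousOn.integrableOn_Ioi_of_le
        ((continuousOn_Ici_of_absolutelyContinuous (he_ac i)).norm.pow 2)
        ((hεi.add hdi).const_mul C₁) (fun t => sq_nonneg _) fun t _ => ?_
      exact (pow_le_pow_left₀ (norm_nonneg _) (norm_le_pi_norm (fun j => e j t) i) 2).trans
        (hdis fun j => e j t)
    · filter_upwards [he_deriv i, ae_restrict_mem measurableSet_Ici] with t
        ⟨e', r, v, he', htd, hr, hv, _, htu⟩ ht
      have ht0 : 0 ≤ t := ht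
      refine ⟨_, he'.norm_sq, mul_le_mul_of_nonneg_left ?_ zero_le_two⟩
      have hc0 : 0 ≤ c := (abs_nonneg _).trans (hc t ht0).1
      rw [hN.inner_eq i, htd, htu]
      refine add_le_add ((real_inner_le_norm _ _).trans ?_) ((real_inner_le_norm _ _).trans ?_)
      · exact mul_le_mul (hCd i t ht0) ((H i).le_opNorm_of_le (hCd i t ht0)) (norm_nonneg _)
          ((norm_nonneg _).trans (hCd i t ht0))
      · refine mul_le_mul ((tu i).le_opNorm_of_le (hRi t ht0)) ?_ (norm_nonneg _)
          (mul_nonneg (norm_nonneg _) ((norm_nonneg _).trans (hRi t ht0)))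
        refine norm_sub_le_of_le (norm_sub_le_of_le (norm_sub_le_of_le ?_ hr) ?_) ?_
        · exact ((tu i).comp A).le_opNorm_of_le (hRi t ht0)
        · rw [norm_smul]
          exact mul_le_mul (hc t ht0).1
            (((tu i).comp (laplacianCLM E a i)).le_opNorm_of_le (hR t ht0)) (norm_nonneg _) hc0
        · rw [norm_smul]
          exact mul_le_mul (hc t ht0).2 hv (norm_nonneg _) hc0
  simpa [Real.sqrt_sq (norm_nonneg _)] using hlim.sqrt

end IsJointlyDetecting

end ErrorDynamics

/-! ### From the matrices of the observer to the abstract network. -/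

theorem Matrix.toEuclideanLin_mul_apply {l m n : Type*} [Fintype m] [Fintype n] [DecidableEq m]
    [DecidableEq n] (P : Matrix l m ℝ) (Q : Matrix m n ℝ) (v : EuclideanSpace ℝ n) :
    (P * Q).toEuclideanLin v = P.toEuclideanLin (Q.toEuclideanLin v) := by
  simp [Matrix.toLpLin_apply, Matrix.mulVec_mulVec]

theorem Matrix.toEuclideanLin_one_apply {n : Type*} [Fintype n] [DecidableEq n]
    (v : EuclideanSpace ℝ n) : (1 : Matrix n n ℝ).toEuclideanLin v = v := by
  simp

theorem Matrix.inner_toEuclideanLin_transpose {m n : Type*} [Fintype m] [Fintype n]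
    [DecidableEq m] [DecidableEq n] (P : Matrix m n ℝ) (v : EuclideanSpace ℝ m)
    (w : EuclideanSpace ℝ n) :
    inner ℝ (P.transpose.toEuclideanLin v) w = inner ℝ v (P.toEuclideanLin w) := by
  rw [← Matrix.conjTranspose_eq_transpose_of_trivial, Matrix.toEuclideanLin_conjTranspose_eq_adjoint,
    LinearMap.adjoint_inner_left]

namespace HeteroMAS

variable {N : ℕ}

theorem CommGraph.eq_of_connected {G : CommGraph N} (hG : G.graph.Connected) {E : Type*}
    {e : Fin N → E} (h : ∀ i j, G.weight i j ≠ 0 → e i = e j) (i j : Fin N) : e i = e j := by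
  obtain ⟨p⟩ := hG.preconnected i j
  induction p with
  | nil => rfl
  | cons hadj _ ih => exact (h _ _ (ne_of_gt hadj)).trans ih

/-- The only property besides `‖v‖ ≤ 1` used of a Filippov selection, so its choice where `w = 0` is
immaterial. -/
theorem inner_of_mem_hSet {k : ℕ} {w v : EuclideanSpace ℝ (Fin k)} (hv : v ∈ hSet w) :
    inner ℝ w v = ‖w‖ := by
  by_cases hw : w = 0
  · simp [hw]
  · rw [hv.2 hw, h, if_neg hw, real_inner_smul_right, real_inner_self_eq_norm_sq, pow_two,
      inv_mul_cancel_left₀ (norm_ne_zero_iff.mpr hw)]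

namespace System

variable (S : System N)

/-- The coordinates of the overall state that belong to agent `i`. -/
noncomputable def ownCLM (i : Fin N) : EuclideanSpace ℝ S.Idx →L[ℝ] EuclideanSpace ℝ (Fin (S.n i)) :=
  (S.Td i).transpose.toEuclideanLin.toContinuousLinearMap

/-- The coordinates of the overall state that do not belong to agent `i`. -/
noncomputable def otherCLM {i : Fin N} (Tu : Matrix S.Idx (Fin (S.codim i)) ℝ) :
    EuclideanSpace ℝ S.Idx →L[ℝ] EuclideanSpace ℝ (Fin (S.codim i)) :=
  Tu.transpose.toEuclideanLin.toContinuousLinearMap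

theorem ownCLM_apply (i : Fin N) (v : EuclideanSpace ℝ S.Idx) :
    S.ownCLM i v = (S.Td i).transpose.toEuclideanLin v := rfl

theorem otherCLM_apply {i : Fin N} (Tu : Matrix S.Idx (Fin (S.codim i)) ℝ)
    (v : EuclideanSpace ℝ S.Idx) : S.otherCLM Tu v = Tu.transpose.toEuclideanLin v := rfl

theorem ownCLM_apply_apply (i : Fin N) (v : EuclideanSpace ℝ S.Idx) (k : Fin (S.n i)) :
    S.ownCLM i v k = v ⟨i, k⟩ := by
  simp [ownCLM, Td, Matrix.toLpLin_apply, Matrix.mulVec, dotProduct]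

theorem ownCLM_stack (i : Fin N) (x : ∀ i, EuclideanSpace ℝ (Fin (S.n i))) :
    S.ownCLM i (S.stack x) = x i := by
  ext k
  rw [ownCLM_apply_apply]
  rfl

theorem eq_of_ownCLM_eq {v w : EuclideanSpace ℝ S.Idx} (h : ∀ i, S.ownCLM i v = S.ownCLM i w) :
    v = w := by
  ext ⟨i, k⟩
  rw [← ownCLM_apply_apply, ← ownCLM_apply_apply, h]

theorem Td_apply_apply (i j : Fin N) (v : EuclideanSpace ℝ (Fin (S.n j))) (k : Fin (S.n i)) :
    (S.Td j).toEuclideanLin v ⟨i, k⟩ = if h : i = j then v (h ▸ k) else 0 := by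
  simp only [Matrix.toLpLin_apply, Matrix.mulVec, dotProduct, Td, Matrix.of_apply, ite_mul,
    one_mul, zero_mul]
  split_ifs with h
  · subst h
    simp
  · exact Finset.sum_eq_zero fun l _ => if_neg fun hl => h (congrArg Sigma.fst hl)

theorem stack_eq_sum (x : ∀ i, EuclideanSpace ℝ (Fin (S.n i))) :
    S.stack x = ∑ j, (S.Td j).toEuclideanLin (x j) := by
  ext ⟨i, k⟩
  rw [WithLp.ofLp_sum, Finset.sum_apply, Finset.sum_eq_single i]
  · rw [Td_apply_apply, dif_pos rfl]
    rfl
  · intro j _ hj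
    rw [Td_apply_apply, dif_neg hj.symm]
  · simp

theorem stack_add (x y : ∀ i, EuclideanSpace ℝ (Fin (S.n i))) :
    S.stack (fun i => x i + y i) = S.stack x + S.stack y := rfl

theorem transpose_Td_mul_Td (i : Fin N) : (S.Td i).transpose * S.Td i = 1 := by
  ext k l
  simp [Matrix.mul_apply, Td, Matrix.one_apply, eq_comm]

theorem bigA_stack (x : ∀ i, EuclideanSpace ℝ (Fin (S.n i))) :
    S.bigA.toEuclideanLin (S.stack x) = S.stack fun i => (S.A i).toEuclideanLin (x i) := by
  ext ⟨i, k⟩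
  simp only [Matrix.toLpLin_apply, Matrix.mulVec, dotProduct, stack, bigA,
    Fintype.sum_sigma]
  rw [Finset.sum_eq_single i]
  · simp
  · intro j _ hj
    exact Finset.sum_eq_zero fun l _ => by
      rw [Matrix.blockDiagonal'_apply_ne _ _ _ hj.symm, zero_mul]
  · simp

variable {S}

theorem IsCompletion.transpose_mul_Td {i : Fin N} {Tu : Matrix S.Idx (Fin (S.codim i)) ℝ}
    (h : S.IsCompletion i Tu) : Tu.transpose * S.Td i = 0 := by
  rw [← Matrix.transpose_transpose (S.Td i), ← Matrix.transpose_mul, h.orth,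
    Matrix.transpose_zero]

theorem IsCompletion.inner_eq {i : Fin N} {Tu : Matrix S.Idx (Fin (S.codim i)) ℝ}
    (h : S.IsCompletion i Tu) (z w : EuclideanSpace ℝ S.Idx) :
    inner ℝ z w = inner ℝ (S.ownCLM i z) (S.ownCLM i w)
      + inner ℝ (S.otherCLM Tu z) (S.otherCLM Tu w) := by
  simp only [ownCLM_apply, otherCLM_apply, Matrix.inner_toEuclideanLin_transpose,
    ← Matrix.toEuclideanLin_mul_apply, ← inner_add_right]
  rw [h.proj, ← LinearMap.add_apply, ← map_add, add_sub_cancel, Matrix.toEuclideanLin_one_apply]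

theorem isJointlyDetecting {G : CommGraph N} (hG : G.graph.Connected)
    {Tu : ∀ i, Matrix S.Idx (Fin (S.codim i)) ℝ} (hTu : ∀ i, S.IsCompletion i (Tu i)) :
    IsJointlyDetecting G.weight S.ownCLM (fun i => S.otherCLM (Tu i)) where
  symm := G.symm
  nonneg := G.nonneg
  consensus _ h := G.eq_of_connected hG h
  inner_eq i := (hTu i).inner_eq
  eq_zero w h := S.eq_of_ownCLM_eq fun i => by rw [h, map_zero]

/-- A common shift cancels in differences, so the measurable disagreement of the estimates is also
that of the unknown errors. -/
theorem epsU_eq_laplacian (G : CommGraph N) (Tu : ∀ i, Matrix S.Idx (Fin (S.codim i)) ℝ)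
    (xhat : Fin N → ℝ → EuclideanSpace ℝ S.Idx) (z : ℝ → EuclideanSpace ℝ S.Idx) (i : Fin N)
    (t : ℝ) : S.epsU G Tu xhat i t = S.otherCLM (Tu i)
      (laplacianCLM (EuclideanSpace ℝ S.Idx) G.weight i fun j => xhat j t - z t) := by
  simp only [laplacianCLM_apply, sub_sub_sub_cancel_right]
  rfl

section Components

variable {i : Fin N} {L : Matrix (Fin (S.n i)) (Fin (S.p i)) ℝ}
  {Tu : Matrix S.Idx (Fin (S.codim i)) ℝ}

theorem IsCompletion.ownCLM_barE (h : S.IsCompletion i Tu) (z : EuclideanSpace ℝ S.Idx) :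
    S.ownCLM i ((S.barE i L Tu).toEuclideanLin z)
      = (S.A i + L * S.C i).toEuclideanLin (S.ownCLM i z) := by
  simp only [ownCLM_apply, ← Matrix.toEuclideanLin_mul_apply]
  rw [barE, Matrix.mul_add, ← Matrix.mul_assoc, ← Matrix.mul_assoc, ← Matrix.mul_assoc,
    ← Matrix.mul_assoc, S.transpose_Td_mul_Td, h.orth, Matrix.one_mul]
  simp

theorem IsCompletion.otherCLM_barE (h : S.IsCompletion i Tu) (z : EuclideanSpace ℝ S.Idx) :
    S.otherCLM Tu ((S.barE i L Tu).toEuclideanLin z)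
      = S.otherCLM Tu (S.bigA.toEuclideanLin z) := by
  simp only [otherCLM_apply, ← Matrix.toEuclideanLin_mul_apply]
  rw [barE, Matrix.mul_add, ← Matrix.mul_assoc, ← Matrix.mul_assoc, ← Matrix.mul_assoc,
    ← Matrix.mul_assoc, h.transpose_mul_Td, h.gram, Matrix.one_mul]
  simp

theorem ownCLM_Td (i : Fin N) (z : EuclideanSpace ℝ (Fin (S.n i))) :
    S.ownCLM i ((S.Td i).toEuclideanLin z) = z := by
  rw [ownCLM_apply, ← Matrix.toEuclideanLin_mul_apply, S.transpose_Td_mul_Td,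
    Matrix.toEuclideanLin_one_apply]

theorem IsCompletion.otherCLM_Td (h : S.IsCompletion i Tu) (z : EuclideanSpace ℝ (Fin (S.n i))) :
    S.otherCLM Tu ((S.Td i).toEuclideanLin z) = 0 := by
  rw [otherCLM_apply, ← Matrix.toEuclideanLin_mul_apply, h.transpose_mul_Td, map_zero,
    LinearMap.zero_apply]

theorem IsCompletion.ownCLM_Tu (h : S.IsCompletion i Tu)
    (z : EuclideanSpace ℝ (Fin (S.codim i))) : S.ownCLM i (Tu.toEuclideanLin z) = 0 := by
  rw [ownCLM_apply, ← Matrix.toEuclideanLin_mul_apply, h.orth, map_zero, LinearMap.zero_apply]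

theorem IsCompletion.otherCLM_Tu (h : S.IsCompletion i Tu)
    (z : EuclideanSpace ℝ (Fin (S.codim i))) : S.otherCLM Tu (Tu.toEuclideanLin z) = z := by
  rw [otherCLM_apply, ← Matrix.toEuclideanLin_mul_apply, h.gram, Matrix.toEuclideanLin_one_apply]

end Components

/-- The overall state is absolutely continuous and solves the stacked dynamics. -/
theorem IsTrajectory.isSolution_stack {u : ∀ i, ℝ → EuclideanSpace ℝ (Fin (S.m i))}
    {x : ∀ i, ℝ → EuclideanSpace ℝ (Fin (S.n i))} (hx : S.IsTrajectory u x) :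
    IsSolution (fun t => S.stack fun j => x j t) fun t =>
      {S.stack fun j => (S.A j).toEuclideanLin (x j t) + (S.B j).toEuclideanLin (u j t)} := by
  refine ⟨fun T hT => ?_, ?_⟩
  · simp only [stack_eq_sum]
    exact AbsolutelyContinuousOnInterval.fun_finset_sum _ fun j _ =>
      ((hx j).ac T hT).lipschitz_comp (S.Td j).toEuclideanLin.toContinuousLinearMap.lipschitz
  · filter_upwards [ae_all_iff.mpr fun j => (hx j).deriv] with t ht
    refine ⟨_, rfl, ?_⟩
    simp only [stack_eq_sum]
    refine HasDerivAt.fun_sum fun j _ => ?_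
    obtain ⟨v, hv, hvd⟩ := ht j
    rw [Set.mem_singleton_iff.mp hv] at hvd
    exact (S.Td j).toEuclideanLin.toContinuousLinearMap.hasFDerivAt.comp_hasDerivAt t hvd

/-- The other agents' inputs are unavailable to agent `i`; a bound uniform in time and agents serves
as the target of every `gams i`. -/
theorem exists_norm_otherCLM_stack_le (Tu : ∀ i, Matrix S.Idx (Fin (S.codim i)) ℝ)
    {u : ∀ i, ℝ → EuclideanSpace ℝ (Fin (S.m i))}
    (hu : ∀ i, ∃ ubar : ℝ, ∀ t : ℝ, 0 ≤ t → ‖u i t‖ ≤ ubar) :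
    ∃ b, ∀ i, ∀ t : ℝ, 0 ≤ t →
      ‖S.otherCLM (Tu i) (S.stack fun j => (S.B j).toEuclideanLin (u j t))‖ ≤ b := by
  choose ubar hubar using hu
  have hstack : ∃ β, ∀ t : ℝ, 0 ≤ t → ‖S.stack fun j => (S.B j).toEuclideanLin (u j t)‖ ≤ β := by
    refine ⟨∑ j, ‖((S.Td j).toEuclideanLin.comp
      (S.B j).toEuclideanLin).toContinuousLinearMap‖ * ubar j, fun t ht => ?_⟩
    rw [stack_eq_sum]
    exact norm_sum_le_of_le _ fun j _ => ContinuousLinearMap.le_opNorm_of_le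
      ((S.Td j).toEuclideanLin.comp (S.B j).toEuclideanLin).toContinuousLinearMap (hubar j t ht)
  obtain ⟨β, hβ⟩ := hstack
  refine ⟨∑ i, ‖S.otherCLM (Tu i)‖ * β, fun i t ht => ?_⟩
  have hβ0 : 0 ≤ β := (norm_nonneg _).trans (hβ 0 le_rfl)
  exact ((S.otherCLM (Tu i)).le_opNorm_of_le (hβ t ht)).trans
    (Finset.single_le_sum (f := fun i => ‖S.otherCLM (Tu i)‖ * β)
      (fun j _ => mul_nonneg (norm_nonneg _) hβ0) (Finset.mem_univ i))

end System

end HeteroMAS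

namespace HeteroMAS.System

variable {N : ℕ} {S : System N}

/-- The estimation error of agent `i` solves a stable equation in its own coordinates and is
driven by the disagreement with its neighbours in the others. -/
theorem IsObserver.ae_error_deriv {G : CommGraph N}
    {L : ∀ i, Matrix (Fin (S.n i)) (Fin (S.p i)) ℝ}
    {Tu : ∀ i, Matrix S.Idx (Fin (S.codim i)) ℝ} (hTu : ∀ i, S.IsCompletion i (Tu i))
    {phi phis : Fin N → ℝ} {u : ∀ i, ℝ → EuclideanSpace ℝ (Fin (S.m i))}
    {x : ∀ i, ℝ → EuclideanSpace ℝ (Fin (S.n i))} (hx : S.IsTrajectory u x)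
    {xhat : Fin N → ℝ → EuclideanSpace ℝ S.Idx} {gam gams : Fin N → ℝ → ℝ}
    (hobs : S.IsObserver G L Tu phi phis u x xhat gam gams) (i : Fin N) :
    ∀ᵐ t ∂(volume.restrict (Set.Ici (0 : ℝ))), ∃ e', ∃ v ∈ hSet (S.epsU G Tu xhat i t),
      HasDerivAt (fun s => xhat i s - S.stack fun j => x j s) e' t ∧
      S.ownCLM i e' = (S.A i + L i * S.C i).toEuclideanLin
        (S.ownCLM i (xhat i t - S.stack fun j => x j t)) ∧
      S.otherCLM (Tu i) e' =
        S.otherCLM (Tu i) (S.bigA.toEuclideanLin (xhat i t - S.stack fun j => x j t))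
        - S.otherCLM (Tu i) (S.stack fun j => (S.B j).toEuclideanLin (u j t))
        - gam i t • S.epsU G Tu xhat i t - gams i t • v := by
  filter_upwards [(hobs.xhat_sol i).deriv, hx.isSolution_stack.deriv] with t
    ⟨w, ⟨v, hv, hw⟩, hwd⟩ ⟨z, hz, hzd⟩
  rw [Set.mem_singleton_iff.mp hz] at hzd
  refine ⟨_, v, hv, hwd.sub hzd, ?_, ?_⟩
  -- The output injection contributes `-L i * C i` applied to the true state, completing `A i + L i
  -- * C i` on the error; the agent's own input cancels.
  · rw [hw]
    simp only [map_sub, map_add, map_smul, ownCLM_stack, (hTu i).ownCLM_barE, (hTu i).ownCLM_Tu,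
      barF, bigB, output, map_neg, LinearMap.neg_apply, LinearMap.add_apply,
      Matrix.toEuclideanLin_mul_apply, ownCLM_Td, smul_zero]
    abel
  · rw [hw]
    have hA := S.bigA_stack fun j => x j t
    simp only [map_sub, map_add, map_smul, (hTu i).otherCLM_barE, (hTu i).otherCLM_Tu,
      barF, bigB, map_neg, LinearMap.neg_apply, Matrix.toEuclideanLin_mul_apply,
      (hTu i).otherCLM_Td, stack_add, hA]
    abel

end HeteroMAS.System

theorem theorem2 {N : ℕ} (S : HeteroMAS.System N) (G : HeteroMAS.CommGraph N)
    (hG : G.graph.Connected)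
    (hdet : ∀ i, HeteroMAS.IsDetectable (S.A i) (S.C i))
    (L : ∀ i, Matrix (Fin (S.n i)) (Fin (S.p i)) ℝ)
    (hL : ∀ i, HeteroMAS.IsHurwitz (S.A i + L i * S.C i))
    (Tu : ∀ i, Matrix S.Idx (Fin (S.codim i)) ℝ)
    (hTu : ∀ i, S.IsCompletion i (Tu i))
    (phi phis : Fin N → ℝ) (hphi : ∀ i, 0 < phi i) (hphis : ∀ i, 0 < phis i)
    (u : ∀ i, ℝ → EuclideanSpace ℝ (Fin (S.m i)))
    (hu : ∀ i, ∃ ubar : ℝ, ∀ t : ℝ, 0 ≤ t → ‖u i t‖ ≤ ubar)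
    (x : ∀ i, ℝ → EuclideanSpace ℝ (Fin (S.n i)))
    (hx : S.IsTrajectory u x)
    (xhat : Fin N → ℝ → EuclideanSpace ℝ S.Idx)
    (gam gams : Fin N → ℝ → ℝ)
    (hobs : S.IsObserver G L Tu phi phis u x xhat gam gams) :
    (∀ i, Tendsto (fun t => ‖xhat i t - S.stack (fun j => x j t)‖) atTop (𝓝 0)) ∧
    (∀ i, ∃ c : ℝ, ∀ t : ℝ, 0 ≤ t → |gam i t| ≤ c ∧ |gams i t| ≤ c) := by
  have hxs := hx.isSolution_stack
  set z : ℝ → EuclideanSpace ℝ S.Idx := fun t => S.stack fun j => x j t with hz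
  have hac : ∀ i, ∀ T : ℝ, 0 ≤ T →
      AbsolutelyContinuousOnInterval (fun t => xhat i t - z t) 0 T :=
    fun i T hT => ((hobs.xhat_sol i).ac T hT).fun_sub (hxs.ac T hT)
  have hderiv := hobs.ae_error_deriv hTu hx
  obtain ⟨b, hb⟩ := HeteroMAS.System.exists_norm_otherCLM_stack_le Tu hu
  have heps := fun i t => S.epsU_eq_laplacian G Tu xhat z i t
  refine (HeteroMAS.System.isJointlyDetecting hG hTu).tendsto_zero_and_bounded
    (fun i => (S.A i + L i * S.C i).toEuclideanLin.toContinuousLinearMap)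
    S.bigA.toEuclideanLin.toContinuousLinearMap (b := b) hphi hphis
    (e := fun i t => xhat i t - z t) hac (fun i => ?_) (fun i => ?_) (fun i => ?_) (fun i => ?_)
  · filter_upwards [hderiv i, ae_restrict_mem measurableSet_Ici] with t
      ⟨e', v, hv, he', hown, hother⟩ ht
    rw [heps] at hv hother
    -- The disturbance `r` is the non-own part of the stacked input.
    exact ⟨e', _, v, he', hown, hb i t ht, hv.1, HeteroMAS.inner_of_mem_hSet hv, hother⟩
  · simpa only [heps] using hobs.gam_sol i
  · simpa only [heps] using hobs.gams_sol i
  · refine (hL i).isBoundedSqIntegrable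
      ⟨fun T hT => (hac i T hT).lipschitz_comp (S.ownCLM i).lipschitz, ?_⟩
    filter_upwards [hderiv i] with t ⟨e', v, _, he', hown, _⟩
    exact ⟨_, hown, (S.ownCLM i).hasFDerivAt.comp_hasDerivAt t he'⟩
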